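/- **Theorem 1.2.** Graphs are undirected and simple, possibly infinite. Let $G$ be a graph with nonempty vertex set $V(G)$, and let $\overline G$ be its complement. The closed neighborhood complex $\mathcal N[\overline G]$ is the abstract simplicial complex whose simplices are the finite sets $\sigma\subset V(G)$ such that $\sigma\subset N_{\overline G}[v]$ for some $v\in V(G)$, where $N_{\overline G}[v]$ consists of $v$ and all vertices adjacent to $v$ in $\overline G$. The independence complex $\mathcal I(H)$ of a graph $H$ is the abstract simplicial complex whose simplices are the finite sets of pairwise non-adjacent vertices of $H$. The canonical double covering $K_2\times G$ is the graph with vertex set $\{1,2\}\times V(G)$ in which $(i,v)$ and $(j,w)$ are adjacent if and only if $i\ne j$ and $v,w$ are adjacent in $G$. Complexes are regarded as topological spaces through their geometric realizations with the weak topology (a set is closed if and only if its intersection with every closed simplex is closed), $\Sigma$ is the unreduced suspension of a space, and $K*L$ is the join of simplicial complexes, whose simplices are the disjoint unions $\sigma\sqcup\tau$ of a (possibly empty) simplex $\sigma$ of $K$ and a (possibly empty) simplex $\tau$ of $L$. Then there is a homotopy equivalence $$\Sigma\,\mathcal N[\overline G]\;\simeq\;\mathcal I(K_2\times G).$$ Moreover,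 if $G$ is bipartite, then $$\Sigma\,\mathcal N[\overline G]\;\simeq\;\mathcal I(G)*\mathcal I(G).$$ -/

import Mathlib

noncomputable section

/-! ### Geometric realization, join and suspension

Abstract simplicial complexes are Mathlib's `PreAbstractSimplicialComplex X`: downward closed
families of nonempty finite subsets of the ground set `X`, where a point of `X` need not be a
vertex. The empty simplex, which every complex is understood to have, is not listed. -/

/-- The topology on the free real vector space `X →₀ ℝ` that is the inductive limit of the
Euclidean topologies of the subspaces `ℝ^A`, for `A` a finite subset of `X`: a set is closed
if and only if its trace on every `ℝ^A` is closed. -/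
@[reducible] def finiteTopology (X : Type*) : TopologicalSpace (X →₀ ℝ) :=
  ⨆ A : Finset X, TopologicalSpace.coinduced
    (fun a : A → ℝ => ∑ x : A, Finsupp.single (x : X) (a x)) inferInstance

namespace PreAbstractSimplicialComplex

/-- The points of the geometric realization: the union of the convex hulls of the simplices,
where a point `x` of the ground set is identified with the basis vector `e_x`. -/
def realizationSet {X : Type*} (K : PreAbstractSimplicialComplex X) : Set (X →₀ ℝ) :=
  ⋃ s ∈ K.faces, convexHull ℝ ((fun x => Finsupp.single x (1 : ℝ)) '' (s : Set X))

/-- The geometric realization `|K|`. -/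
def Realization {X : Type*} (K : PreAbstractSimplicialComplex X) : Type _ :=
  {p : X →₀ ℝ // p ∈ K.realizationSet}

/-- `|K|` carries the subspace topology of the inductive limit topology. -/
instance {X : Type*} (K : PreAbstractSimplicialComplex X) : TopologicalSpace K.Realization :=
  TopologicalSpace.induced Subtype.val (finiteTopology X)

/-- The join `K * L`, on the disjoint union of the ground sets: its simplices are the disjoint
unions `s ⊔ t` of a simplex `s` of `K` and a simplex `t` of `L`. Here `s` or `t` may be the empty
simplex. -/
def join {X Y : Type*} (K : PreAbstractSimplicialComplex X) (L : PreAbstractSimplicialComplex Y) :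
    PreAbstractSimplicialComplex (X ⊕ Y) where
  faces := {s | s.Nonempty ∧ (s.toLeft = ∅ ∨ s.toLeft ∈ K.faces) ∧
    (s.toRight = ∅ ∨ s.toRight ∈ L.faces)}
  isRelLowerSet_faces := by
    rintro s ⟨hs, hl, hr⟩
    refine ⟨hs, fun t hts ht => ⟨ht, ?_, ?_⟩⟩
    · have h : t.toLeft ⊆ s.toLeft := Finset.toLeft_subset_toLeft hts
      rcases t.toLeft.eq_empty_or_nonempty with h0 | h0
      · exact Or.inl h0
      · rcases hl with hl | hl
        · exact Or.inl (Finset.subset_empty.mp (hl ▸ h))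
        · exact Or.inr ((K.isRelLowerSet_faces hl).2 h h0)
    · have h : t.toRight ⊆ s.toRight := Finset.toRight_subset_toRight hts
      rcases t.toRight.eq_empty_or_nonempty with h0 | h0
      · exact Or.inl h0
      · rcases hr with hr | hr
        · exact Or.inl (Finset.subset_empty.mp (hr ▸ h))
        · exact Or.inr ((L.isRelLowerSet_faces hr).2 h h0)

end PreAbstractSimplicialComplex

/-- The gluing relation of the suspension: the end `X × {0}` of the cylinder is glued to the pole
`false`, and the end `X × {1}` to the pole `true`. -/
inductive SuspensionRel (X : Type*) : (X × unitInterval) ⊕ Bool → (X × unitInterval) ⊕ Bool → Prop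
  | zero (x : X) : SuspensionRel X (Sum.inl (x, 0)) (Sum.inr false)
  | one (x : X) : SuspensionRel X (Sum.inl (x, 1)) (Sum.inr true)

/-- The (unreduced) suspension of a topological space: the cylinder `X × [0,1]` with each of its
two ends collapsed to a pole. The suspension of the empty space consists of the two poles. -/
def Suspension (X : Type*) : Type _ := Quot (SuspensionRel X)

/-- The suspension carries the quotient topology. -/
instance (X : Type*) [TopologicalSpace X] : TopologicalSpace (Suspension X) :=
  inferInstanceAs (TopologicalSpace (Quot (SuspensionRel X)))

/-! ### Graphs and their complexes -/

namespace SimpleGraph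

/-- The categorical product `G × H`. -/
def categoricalProduct {V W : Type*} (G : SimpleGraph V) (H : SimpleGraph W) :
    SimpleGraph (V × W) where
  Adj p q := G.Adj p.1 q.1 ∧ H.Adj p.2 q.2
  symm := ⟨fun _ _ h => ⟨h.1.symm, h.2.symm⟩⟩
  loopless := ⟨fun _ h => G.irrefl h.1⟩

/-- The canonical double covering `K₂ × G`. -/
def canonicalDoubleCovering {V : Type*} (G : SimpleGraph V) : SimpleGraph (Fin 2 × V) :=
  (completeGraph (Fin 2)).categoricalProduct G

/-- The independence complex: its simplices are the finite independent sets of vertices. -/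
def independenceComplex {V : Type*} (G : SimpleGraph V) : PreAbstractSimplicialComplex V where
  faces := {s | s.Nonempty ∧ G.IsIndepSet (s : Set V)}
  isRelLowerSet_faces := fun _ hs =>
    ⟨hs.1, fun _ hts ht => ⟨ht, Set.Pairwise.mono (Finset.coe_subset.mpr hts) hs.2⟩⟩

/-- The closed neighborhood `N_G[v]`. -/
def closedNeighborhood {V : Type*} (G : SimpleGraph V) (v : V) : Set V :=
  G.neighborSet v ∪ {v}

/-- The closed neighborhood complex: its simplices are the finite sets of vertices that are
contained in the closed neighborhood of some vertex. -/
def closedNeighborhoodComplex {V : Type*} (G : SimpleGraph V) :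
    PreAbstractSimplicialComplex V where
  faces := {s | s.Nonempty ∧ ∃ v, (s : Set V) ⊆ G.closedNeighborhood v}
  isRelLowerSet_faces := fun _ hs =>
    ⟨hs.1, fun _ hts ht => ⟨ht, hs.2.imp fun _ hv => (Finset.coe_subset.mpr hts).trans hv⟩⟩

end SimpleGraph

end

/-! The theorem is a statement about an arbitrary nonempty relation `R` between sets `X` and `Y`,
here the relation "not adjacent in `G`" on `V`. Its Dowker complex consists of the finite sets of
points with a common neighbour under `R`, and this is `𝒩[Gᶜ]`. Its biclique complex, on `X ⊔ Y`,
consists of the sets `A ⊔ B` with `A × B ⊆ R`, and this is `ℐ(K₂ × G)`. If `G` is bipartite,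
exchanging the two copies of each vertex of one color also identifies it with `ℐ(G) * ℐ(G)`. So it
suffices that the suspension of the Dowker complex is homotopy equivalent to the biclique complex
(`nonempty_suspension_dowkerComplex_homotopyEquiv`).

The reason is that the biclique complex is the union of the full simplices on `X` and on `Y`, both
contractible, and of the part in between, which projects to the Dowker complex with contractible
fibres. The proof makes this explicit. A point `z` of the biclique complex has a left part and a
right part, and is sent to the direction of its left part, at a height that is given by the mass of
its right part (`toSuspension`). In the other direction, a point `a` of the Dowker complex needs a
continuous choice of common neighbours. Choose a common neighbour `y A` of every simplex `A`. Let
`upperPart a` be the part of `a` above the level `halfNormSq a`, and let `lowerPart y a` be a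
combination of the points `y A`, where `A` runs through the subsets of the support of `a` that
contain the support of `upperPart a`. Then every point in the support of `upperPart a` is related to
every point in the support of `lowerPart y a`. The line over `a` in the suspension is mapped to the
path from a base vertex `x₀` through `upperPart a` and `lowerPart y a` to a base vertex `y₀`
(`pathPoint`, `ofSuspension`).

Both composites are homotopic to the identity by straight lines. On the suspension, the composite
is `upperMap`, which shrinks supports, combined with a change of height. On the biclique complex,
the composite is compared with the identity through `cutMap`; at each stage the two images of a
point lie in a common simplex (`homotopic_of_common_face`).

Since the complexes may be infinite, continuity is checked on closed simplices
(`isCoherentWith_closedSimplex`), where the maps take values in a single `ℝ^B`. For homotopies the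
same is done on the product with the unit interval, by currying. Most maps are defined by nonzero
nonnegative functions whose supports are simplices (`cone`), which are then scaled to total
mass `1` (`normalize`). -/

open Topology Set

/-! ### The finite topology on a free real vector space -/

theorem Finsupp.degree_smul_real {X : Type*} (c : ℝ) (p : X →₀ ℝ) :
    (c • p).degree = c * p.degree := by
  rw [Finsupp.degree_apply, Finsupp.degree_apply, Finset.mul_sum]
  exact Finset.sum_subset Finsupp.support_smul fun x _ hx => Finsupp.notMem_support_iff.1 hx

section FiniteTopology

attribute [local instance] finiteTopology

variable {X T Z : Type*}

theorem Finsupp.sum_attach_single_apply (A : Finset X) (a : A → ℝ) (x : A) :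
    (∑ y : A, Finsupp.single (y : X) (a y)) (x : X) = a x := by
  classical
  rw [Finsupp.finsetSum_apply, Finset.sum_eq_single x]
  · simp
  · intro y _ hy
    exact Finsupp.single_eq_of_ne fun h => hy (Subtype.ext h.symm)
  · simp

theorem Finsupp.support_sum_attach_single_subset (A : Finset X) (a : A → ℝ) :
    (∑ y : A, Finsupp.single (y : X) (a y)).support ⊆ A := by
  classical
  refine Finsupp.support_finsetSum.trans (Finset.biUnion_subset.2 fun y _ => ?_)
  exact Finsupp.support_single_subset.trans (by simp)

theorem Finsupp.sum_attach_single_eq_self {A : Finset X} {p : X →₀ ℝ} (hp : p.support ⊆ A) :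
    ∑ y : A, Finsupp.single (y : X) (p y) = p := by
  ext x
  by_cases hx : x ∈ A
  · exact Finsupp.sum_attach_single_apply A (fun y => p y) ⟨x, hx⟩
  · rw [Finsupp.notMem_support_iff.1 fun h => hx (hp h), Finsupp.notMem_support_iff.1
      fun h => hx (Finsupp.support_sum_attach_single_subset A _ h)]

theorem continuous_sum_attach_single (A : Finset X) :
    Continuous fun a : A → ℝ => ∑ y : A, Finsupp.single (y : X) (a y) :=
  continuous_iSup_rng (i := A) continuous_coinduced_rng

/-- Fibrewise continuous sums are continuous, because on each `ℝ^A` they are finite sums. -/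
theorem continuous_finsuppSum {c : X → ℝ → ℝ} (hc : ∀ x, Continuous (c x)) (h0 : ∀ x, c x 0 = 0) :
    Continuous fun p : X →₀ ℝ => p.sum c := by
  rw [continuous_iSup_dom]
  intro A
  rw [continuous_coinduced_dom]
  have : ((fun p : X →₀ ℝ => p.sum c) ∘ fun a : A → ℝ => ∑ y : A, Finsupp.single (y : X) (a y)) =
      fun a => ∑ y : A, c y (a y) := by
    funext a
    rw [Function.comp_apply, Finsupp.sum_of_support_subset _
      (Finsupp.support_sum_attach_single_subset A a) _ fun x _ => h0 x, ← Finset.sum_coe_sort]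
    exact Finset.sum_congr rfl fun y _ => by rw [Finsupp.sum_attach_single_apply]
  rw [this]
  exact continuous_finsetSum _ fun y _ => (hc y).comp (continuous_apply y)

theorem continuous_finsupp_apply (x : X) : Continuous fun p : X →₀ ℝ => p x := by
  classical
  convert continuous_finsuppSum (X := X) (c := fun y r => if y = x then r else 0)
    (fun y => by split_ifs <;> fun_prop) (by simp) using 2 with p
  simp +contextual [Finsupp.sum, eq_comm]

theorem continuous_finsupp_degree : Continuous fun p : X →₀ ℝ => p.degree :=
  continuous_finsuppSum (c := fun _ r => r) (fun _ => continuous_id) fun _ => rfl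

instance : T2Space (X →₀ ℝ) :=
  T2Space.of_injective_continuous (f := fun (p : X →₀ ℝ) (x : X) => p x) DFunLike.coe_injective
    (continuous_pi continuous_finsupp_apply)

/-- A map with values in a single `ℝ^B` is continuous as soon as its coordinates are. -/
theorem continuousOn_finsupp_of_support_subset [TopologicalSpace T] {f : T → X →₀ ℝ} {U : Set T}
    (B : Finset X) (hB : ∀ t ∈ U, (f t).support ⊆ B)
    (hf : ∀ x ∈ B, ContinuousOn (fun t => f t x) U) : ContinuousOn f U := by
  refine ((continuous_sum_attach_single B).comp_continuousOn
    (f := fun t (y : B) => f t y) (continuousOn_pi.2 fun y => hf y y.2)).congr fun t ht => ?_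
  exact (Finsupp.sum_attach_single_eq_self (hB t ht)).symm

/-- Compact sets for the finite topology lie in a single `ℝ^B`: otherwise there would be points
`p n` of the set with nonzero coordinates at pairwise distinct places `x n`, and the continuous
weighted `ℓ¹`-norm with weight `n / |p n (x n)|` at `x n` would be unbounded. -/
theorem IsCompact.exists_support_subset {C : Set (X →₀ ℝ)} (hC : IsCompact C) :
    ∃ B : Finset X, ∀ p ∈ C, p.support ⊆ B := by
  classical
  by_cases hfin : {x | ∃ p ∈ C, p x ≠ 0}.Finite
  · exact ⟨hfin.toFinset, fun p hp x hx => by simpa using ⟨p, hp, by simpa using hx⟩⟩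
  exfalso
  let x := Set.Infinite.natEmbedding _ hfin
  choose p hp hpx using fun n => (x n).2
  let w : X → ℝ := fun y => ∑ᶠ (n : ℕ) (_ : (x n : X) = y), n / |p n (x n)|
  have hw : ∀ n, w (x n) = n / |p n (x n)| := fun n => by
    have : ∀ m, (x m : X) = x n ↔ m = n := fun m =>
      ⟨fun h => x.injective (Subtype.ext h), fun h => h ▸ rfl⟩
    simp only [w, this]
    simp
  have hw0 : ∀ y, 0 ≤ w y := fun y =>
    finsum_nonneg fun n => finsum_nonneg fun _ => by positivity
  have hcont : Continuous fun q : X →₀ ℝ => q.sum fun y r => w y * |r| :=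
    continuous_finsuppSum (fun y => by fun_prop) (by simp)
  obtain ⟨M, hM⟩ := (hC.image hcont).bddAbove
  obtain ⟨n, hn⟩ := exists_nat_gt M
  have h1 : (p n).sum (fun y r => w y * |r|) ≤ M := hM ⟨p n, hp n, rfl⟩
  have h2 : w (x n) * |p n (x n)| ≤ (p n).sum fun y r => w y * |r| :=
    Finset.single_le_sum (f := fun y => w y * |p n y|)
      (fun y _ => mul_nonneg (hw0 y) (abs_nonneg _)) (Finsupp.mem_support_iff.2 (hpx n))
  rw [hw, div_mul_cancel₀ _ (abs_ne_zero.2 (hpx n))] at h2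
  linarith

end FiniteTopology

/-! ### Geometric realizations -/

namespace PreAbstractSimplicialComplex

variable {X Y T Z : Type*}

theorem mem_faces_of_subset (K : PreAbstractSimplicialComplex X) {s t : Finset X}
    (hs : s ∈ K.faces) (hts : t ⊆ s) (ht : t.Nonempty) : t ∈ K.faces :=
  (K.isRelLowerSet_faces hs).2 hts ht

/-- Points of the realization, in barycentric coordinates. -/
theorem mem_realizationSet {K : PreAbstractSimplicialComplex X} {p : X →₀ ℝ} :
    p ∈ K.realizationSet ↔ (∀ x, 0 ≤ p x) ∧ p.degree = 1 ∧ p.support ∈ K.faces := by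
  classical
  simp only [realizationSet, mem_iUnion, exists_prop]
  constructor
  · rintro ⟨s, hs, hp⟩
    have hconv : Convex ℝ {q : X →₀ ℝ | (∀ x, 0 ≤ q x) ∧ q.degree = 1 ∧ q.support ⊆ s} := by
      rintro q ⟨hq0, hq1, hqs⟩ r ⟨hr0, hr1, hrs⟩ a b ha hb hab
      refine ⟨fun x => ?_, ?_, ?_⟩
      · exact add_nonneg (mul_nonneg ha (hq0 x)) (mul_nonneg hb (hr0 x))
      · rw [map_add, Finsupp.degree_smul_real, Finsupp.degree_smul_real, hq1, hr1]
        linarith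
      · exact Finsupp.support_add.trans (Finset.union_subset
          (Finsupp.support_smul.trans hqs) (Finsupp.support_smul.trans hrs))
    obtain ⟨h0, h1, h2⟩ := convexHull_min (by
      rintro _ ⟨x, hx, rfl⟩
      refine ⟨fun y => ?_, Finsupp.degree_single _ _, Finsupp.support_single_subset.trans ?_⟩
      · simp only [Finsupp.single_apply]
        split_ifs <;> norm_num
      · simpa using hx) hconv hp
    refine ⟨h0, h1, K.mem_faces_of_subset hs h2 ?_⟩
    rw [Finsupp.support_nonempty_iff]
    rintro rfl
    simp at h1
  · rintro ⟨h0, h1, h2⟩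
    refine ⟨p.support, h2, ?_⟩
    have := (convex_convexHull ℝ ((fun x => Finsupp.single x (1 : ℝ)) ''
      (p.support : Set X))).sum_mem (t := p.support) (w := p)
      (z := fun x => Finsupp.single x (1 : ℝ)) (fun x _ => h0 x) h1
      fun x hx => subset_convexHull _ _ ⟨x, hx, rfl⟩
    simpa [Finsupp.smul_single, ← Finsupp.sum.eq_1 p fun x r => Finsupp.single x r] using this

end PreAbstractSimplicialComplex

namespace PreAbstractSimplicialComplex

attribute [local instance] finiteTopology

variable {X Y T Z : Type*} {K : PreAbstractSimplicialComplex X} {L : PreAbstractSimplicialComplex Y}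

namespace Realization

theorem nonneg (p : K.Realization) (x : X) : 0 ≤ p.1 x := (mem_realizationSet.1 p.2).1 x

theorem degree_eq_one (p : K.Realization) : p.1.degree = 1 := (mem_realizationSet.1 p.2).2.1

theorem support_mem_faces (p : K.Realization) : p.1.support ∈ K.faces :=
  (mem_realizationSet.1 p.2).2.2

theorem isInducing_val : IsInducing fun p : K.Realization => p.1 := ⟨rfl⟩

theorem continuous_apply (x : X) : Continuous fun p : K.Realization => p.1 x :=
  (continuous_finsupp_apply x).comp isInducing_val.continuous

/-- The closed simplex of the realization that is spanned by the vertices in `s`. -/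
def closedSimplex (K : PreAbstractSimplicialComplex X) (s : Finset X) :
    Set K.Realization :=
  {p | p.1.support ⊆ s}

theorem isCompact_closedSimplex {s : Finset X} (hs : s ∈ K.faces) :
    IsCompact (closedSimplex K s) := by
  rw [isInducing_val.isCompact_iff]
  convert (isCompact_stdSimplex ℝ s).image (continuous_sum_attach_single s) using 1
  ext p
  constructor
  · rintro ⟨p, hp, rfl⟩
    refine ⟨fun y => p.1 y, ⟨fun y => p.nonneg y, ?_⟩, Finsupp.sum_attach_single_eq_self hp⟩
    rw [Finset.sum_coe_sort s fun y => p.1 y, ← p.degree_eq_one, Finsupp.degree_apply]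
    exact (Finset.sum_subset hp fun x _ hx => Finsupp.notMem_support_iff.1 hx).symm
  · rintro ⟨a, ⟨ha0, ha1⟩, rfl⟩
    set q := ∑ y : s, Finsupp.single (y : X) (a y) with hq
    have hqs : q.support ⊆ s := Finsupp.support_sum_attach_single_subset s a
    have hd : q.degree = 1 := by
      rw [hq, map_sum, ← ha1]
      exact Finset.sum_congr rfl fun y _ => Finsupp.degree_single _ _
    refine ⟨⟨q, mem_realizationSet.2 ⟨fun x => ?_, hd, K.mem_faces_of_subset hs hqs ?_⟩⟩, hqs, rfl⟩
    · by_cases hx : x ∈ s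
      · exact (ha0 ⟨x, hx⟩).trans_eq (Finsupp.sum_attach_single_apply s a ⟨x, hx⟩).symm
      · exact (Finsupp.notMem_support_iff.1 fun h => hx (hqs h)).ge
    · rw [Finsupp.support_nonempty_iff]
      rintro h
      simp [h] at hd

/-- The subspace topology on the realization is the weak topology with respect to the closed
simplices: the trace of the realization on each `ℝ^A` is a finite union of simplices. -/
theorem isCoherentWith_closedSimplex :
    IsCoherentWith {C | ∃ s ∈ K.faces, C = closedSimplex K s} := by
  classical
  refine .of_isClosed fun t ht => ?_
  have hcell : ∀ s ∈ K.faces,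
      IsCompact ((fun p : K.Realization => p.1) '' (closedSimplex K s ∩ t)) := fun s hs => by
    have := isCompact_iff_compactSpace.1 (isCompact_closedSimplex hs)
    have h := ((ht _ ⟨s, hs, rfl⟩).isCompact.image continuous_subtype_val).image
      (isInducing_val (K := K)).continuous
    rwa [Subtype.image_preimage_coe] at h
  refine isInducing_val.isClosed_iff.2 ⟨(fun p : K.Realization => p.1) '' t, ?_,
    Set.preimage_image_eq _ Subtype.val_injective⟩
  rw [← isOpen_compl_iff, isOpen_iSup_iff]
  intro A
  rw [isOpen_coinduced, Set.preimage_compl, isOpen_compl_iff]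
  have h : IsClosed (⋃ s ∈ {s | s ∈ A.powerset ∧ s ∈ K.faces},
      (fun p : K.Realization => p.1) '' (closedSimplex K s ∩ t)) :=
    (A.powerset.finite_toSet.subset fun s hs => hs.1).isClosed_biUnion
      fun s hs => (hcell s hs.2).isClosed
  convert h.preimage (continuous_sum_attach_single A) using 1
  ext a
  simp only [mem_preimage, mem_iUnion, mem_ofPred_eq, Finset.mem_powerset, exists_prop]
  constructor
  · rintro ⟨p, hp, hpa⟩
    refine ⟨p.1.support, ⟨?_, p.support_mem_faces⟩, p, ⟨Finset.Subset.refl _, hp⟩, hpa⟩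
    have h := Finsupp.support_sum_attach_single_subset A a
    rwa [← hpa] at h
  · rintro ⟨s, -, p, hp, hpa⟩
    exact ⟨p, hp.2, hpa⟩

theorem continuous_of_closedSimplex [TopologicalSpace Z] {f : K.Realization → Z}
    (hf : ∀ s ∈ K.faces, ContinuousOn f (closedSimplex K s)) : Continuous f :=
  isCoherentWith_closedSimplex.continuous_iff.2 <| by
    rintro _ ⟨s, hs, rfl⟩
    exact hf s hs

/-- The product with a locally compact space is still coherent with the products of the closed
simplices, by currying. -/
theorem continuous_of_closedSimplex_prod [TopologicalSpace Z] [TopologicalSpace T]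
    [LocallyCompactSpace T] {f : K.Realization × T → Z}
    (hf : ∀ s ∈ K.faces, ContinuousOn f (closedSimplex K s ×ˢ univ)) : Continuous f := by
  have hp : ∀ p, Continuous fun t => f (p, t) := fun p =>
    (hf _ p.support_mem_faces).comp_continuous (Continuous.prodMk_right p)
      fun t => ⟨Finset.Subset.refl _, mem_univ t⟩
  let F : K.Realization → C(T, Z) := fun p => ⟨_, hp p⟩
  have hF : Continuous F := continuous_of_closedSimplex fun s hs =>
    ContinuousMap.continuousOn_of_continuousOn_uncurry F (hf s hs)
  exact ContinuousMap.continuous_uncurry_of_continuous ⟨F, hF⟩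

theorem continuousOn_of_support_subset [TopologicalSpace T] {f : T → K.Realization} {U : Set T}
    (B : Finset X) (hB : ∀ t ∈ U, (f t).1.support ⊆ B)
    (hf : ∀ x ∈ B, ContinuousOn (fun t => (f t).1 x) U) : ContinuousOn f U :=
  isInducing_val.continuousOn_iff.2 (continuousOn_finsupp_of_support_subset B hB hf)

/-- A map to the realization is continuous on a set on which it is the normalization of a map with
continuous coordinates and values in a single `ℝ^B`. -/
theorem continuousOn_of_eq_normalization [TopologicalSpace T] {f : T → K.Realization} {U : Set T}
    {F : T → X →₀ ℝ} (B : Finset X) (hB : ∀ t ∈ U, (F t).support ⊆ B)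
    (hF : ∀ x ∈ B, ContinuousOn (fun t => F t x) U)
    (h : ∀ t ∈ U, (f t).1 = (F t).degree⁻¹ • F t) : ContinuousOn f U := by
  have hd : ContinuousOn (fun t => (F t).degree) U :=
    continuous_finsupp_degree.comp_continuousOn (continuousOn_finsupp_of_support_subset B hB hF)
  have hd0 : ∀ t ∈ U, (F t).degree ≠ 0 := fun t ht h0 => by
    have := (f t).degree_eq_one
    simp [h t ht, h0] at this
  refine continuousOn_of_support_subset B (fun t ht => ?_) fun x hx => ?_
  · rw [h t ht]
    exact Finsupp.support_smul.trans (hB t ht)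
  · exact ((hd.inv₀ hd0).mul (hF x hx)).congr fun t ht => by
      rw [h t ht]
      rfl

end Realization

/-- The finitely supported functions that are positive multiples of points of the realization. -/
noncomputable def cone (K : PreAbstractSimplicialComplex X) : Set (X →₀ ℝ) :=
  {P | (∀ x, 0 ≤ P x) ∧ P.support ∈ K.faces}

theorem degree_pos_of_mem_cone {P : X →₀ ℝ} (hP : P ∈ K.cone) : 0 < P.degree := by
  rw [Finsupp.degree_apply]
  exact Finset.sum_pos (fun x hx => (hP.1 x).lt_of_ne' (Finsupp.mem_support_iff.1 hx))
    (K.isRelLowerSet_faces hP.2).1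

/-- The point of the realization on the ray through `P`. -/
noncomputable def normalize (P : X →₀ ℝ) (hP : P ∈ K.cone) : K.Realization :=
  ⟨P.degree⁻¹ • P, mem_realizationSet.2 ⟨fun x =>
      mul_nonneg (inv_nonneg.2 (degree_pos_of_mem_cone hP).le) (hP.1 x), by
    rw [Finsupp.degree_smul_real, inv_mul_cancel₀ (degree_pos_of_mem_cone hP).ne'], by
    rw [Finsupp.support_smul_eq (inv_ne_zero (degree_pos_of_mem_cone hP).ne')]
    exact hP.2⟩⟩

theorem support_normalize {P : X →₀ ℝ} (hP : P ∈ K.cone) :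
    (normalize P hP).1.support = P.support :=
  Finsupp.support_smul_eq (inv_ne_zero (degree_pos_of_mem_cone hP).ne')

namespace Realization

/-- Two maps between realizations are homotopic, by straight lines, if the images of each point
lie in a common simplex. -/
theorem homotopic_of_common_face (f g : C(K.Realization, L.Realization))
    (h : ∀ p, ∃ s ∈ L.faces, (f p).1.support ⊆ s ∧ (g p).1.support ⊆ s) : f.Homotopic g := by
  classical
  let P : K.Realization × unitInterval → Y →₀ ℝ := fun q =>
    (1 - (q.2 : ℝ)) • (f q.1).1 + (q.2 : ℝ) • (g q.1).1
  have hPs : ∀ q, (P q).support ⊆ (f q.1).1.support ∪ (g q.1).1.support := fun q =>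
    Finsupp.support_add.trans (Finset.union_subset_union Finsupp.support_smul Finsupp.support_smul)
  have hP1 : ∀ q, (P q).degree = 1 := fun q => by
    simp only [P, map_add, Finsupp.degree_smul_real, degree_eq_one]
    ring
  have hPm : ∀ q, P q ∈ L.realizationSet := fun q => by
    refine mem_realizationSet.2 ⟨fun y => ?_, hP1 q, ?_⟩
    · exact add_nonneg (mul_nonneg (sub_nonneg.2 q.2.2.2) ((f q.1).nonneg y))
        (mul_nonneg q.2.2.1 ((g q.1).nonneg y))
    · obtain ⟨s, hs, hf, hg⟩ := h q.1
      refine L.mem_faces_of_subset hs ((hPs q).trans (Finset.union_subset hf hg)) ?_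
      rw [Finsupp.support_nonempty_iff]
      intro h0
      simpa [h0] using hP1 q
  let H : K.Realization × unitInterval → L.Realization := fun q => ⟨P q, hPm q⟩
  have hH : Continuous H := by
    refine continuous_of_closedSimplex_prod fun s hs => ?_
    have key : ∀ k : C(K.Realization, L.Realization), ∃ B : Finset Y,
        ∀ p ∈ closedSimplex K s, (k p).1.support ⊆ B := fun k => by
      obtain ⟨B, hB⟩ := (((isCompact_closedSimplex hs).image k.continuous).image
        isInducing_val.continuous).exists_support_subset
      exact ⟨B, fun p hp => hB _ ⟨k p, ⟨p, hp, rfl⟩, rfl⟩⟩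
    obtain ⟨B, hB⟩ := key f
    obtain ⟨C, hC⟩ := key g
    refine continuousOn_of_support_subset (B ∪ C) (fun q hq => (hPs q).trans
      (Finset.union_subset_union (hB _ hq.1) (hC _ hq.1))) fun y _ => Continuous.continuousOn ?_
    have hf : Continuous fun q : K.Realization × unitInterval => (f q.1).1 y :=
      (continuous_apply y).comp (f.continuous.comp continuous_fst)
    have hg : Continuous fun q : K.Realization × unitInterval => (g q.1).1 y :=
      (continuous_apply y).comp (g.continuous.comp continuous_fst)
    have ht : Continuous fun q : K.Realization × unitInterval => (q.2 : ℝ) := by fun_prop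
    exact ((continuous_const.sub ht).mul hf).add (ht.mul hg)
  exact ⟨{
    toFun := fun q => H q.swap
    continuous_toFun := hH.comp continuous_swap
    map_zero_left := fun p => Subtype.ext (by simp [H, P])
    map_one_left := fun p => Subtype.ext (by simp [H, P]) }⟩

/-- The map of realizations induced by a bijection of the ground sets that preserves faces. -/
noncomputable def mapEquiv (e : X ≃ Y) (h : ∀ s ∈ K.faces, s.map e.toEmbedding ∈ L.faces) :
    C(K.Realization, L.Realization) where
  toFun p := ⟨Finsupp.equivMapDomain e p.1, mem_realizationSet.2
    ⟨fun y => p.nonneg (e.symm y), by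
      rw [Finsupp.equivMapDomain_eq_mapDomain, Finsupp.degree_mapDomain]
      exact p.degree_eq_one, h _ p.support_mem_faces⟩⟩
  continuous_toFun := continuous_of_closedSimplex fun s _ =>
    continuousOn_of_support_subset (s.map e.toEmbedding)
      (fun _ hp => Finset.map_subset_map.2 hp)
      fun y _ => (continuous_apply (e.symm y)).continuousOn

/-- Isomorphic complexes have homeomorphic realizations. -/
noncomputable def homeomorphOfEquiv (e : X ≃ Y)
    (h : ∀ s, s.map e.toEmbedding ∈ L.faces ↔ s ∈ K.faces) :
    K.Realization ≃ₜ L.Realization where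
  toFun := mapEquiv e fun s => (h s).2
  invFun := mapEquiv e.symm fun s hs => (h _).1 (by
    rwa [Finset.map_map, ← Equiv.trans_toEmbedding, Equiv.symm_trans_self,
      Equiv.refl_toEmbedding, Finset.map_refl])
  left_inv p := Subtype.ext (Finsupp.ext fun x => congrArg p.1 (e.symm_apply_apply x))
  right_inv p := Subtype.ext (Finsupp.ext fun y => congrArg p.1 (e.apply_symm_apply y))
  continuous_toFun := (mapEquiv e _).continuous
  continuous_invFun := (mapEquiv e.symm _).continuous

end Realization

end PreAbstractSimplicialComplex

/-! ### Splitting a function by its level -/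

section Levels

variable {X Y : Type*}

/-- Half of the squared Euclidean norm. If the nonnegative function `a` has total mass `1`, this is
a level that depends continuously on `a` and lies strictly below the maximum of `a`. -/
noncomputable def halfNormSq (a : X →₀ ℝ) : ℝ := (a.sum fun _ r => r ^ 2) / 2

theorem halfNormSq_nonneg (a : X →₀ ℝ) : 0 ≤ halfNormSq a :=
  div_nonneg (Finset.sum_nonneg fun _ _ => sq_nonneg _) zero_le_two

theorem halfNormSq_pos {a : X →₀ ℝ} (ha : a ≠ 0) : 0 < halfNormSq a :=
  div_pos (Finset.sum_pos (fun _ hx => sq_pos_iff.2 (Finsupp.mem_support_iff.1 hx))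
    (Finsupp.support_nonempty_iff.2 ha))
    zero_lt_two

theorem halfNormSq_smul (c : ℝ) (a : X →₀ ℝ) : halfNormSq (c • a) = c ^ 2 * halfNormSq a := by
  rw [halfNormSq, halfNormSq, Finsupp.sum_smul_index (by simp), mul_div_assoc', Finsupp.mul_sum]
  simp only [mul_pow]

theorem Finsupp.sum_le_degree_of_nonneg {a : X →₀ ℝ} (ha : ∀ x, 0 ≤ a x) {A : Finset X} :
    ∑ x ∈ A, a x ≤ a.degree := by
  classical
  rw [Finsupp.degree_apply]
  calc ∑ x ∈ A, a x ≤ ∑ x ∈ A ∪ a.support, a x :=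
        Finset.sum_le_sum_of_subset_of_nonneg Finset.subset_union_left fun x _ _ => ha x
    _ = ∑ x ∈ a.support, a x :=
        (Finset.sum_subset Finset.subset_union_right
          fun x _ hx => Finsupp.notMem_support_iff.1 hx).symm

/-- The part of `a` above the level `halfNormSq a`, scaled to be homogeneous of degree two. -/
noncomputable def upperPart (a : X →₀ ℝ) : X →₀ ℝ :=
  a.mapRange (fun r => max 0 (r * a.degree - halfNormSq a))
    (by simpa using halfNormSq_nonneg a)

theorem upperPart_apply (a : X →₀ ℝ) (x : X) :
    upperPart a x = max 0 (a x * a.degree - halfNormSq a) := rfl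

theorem upperPart_nonneg (a : X →₀ ℝ) (x : X) : 0 ≤ upperPart a x := le_max_left _ _

theorem mem_support_upperPart {a : X →₀ ℝ} {x : X} :
    x ∈ (upperPart a).support ↔ halfNormSq a < a x * a.degree := by
  rw [Finsupp.mem_support_iff, upperPart_apply, ne_eq, max_eq_left_iff, not_le, sub_pos]

theorem support_upperPart_subset (a : X →₀ ℝ) : (upperPart a).support ⊆ a.support :=
  Finsupp.support_mapRange

theorem support_upperPart_smul {c : ℝ} (hc : 0 < c) (a : X →₀ ℝ) :
    (upperPart (c • a)).support = (upperPart a).support := by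
  ext x
  rw [mem_support_upperPart, mem_support_upperPart, halfNormSq_smul, Finsupp.degree_smul_real,
    Finsupp.smul_apply, smul_eq_mul, mul_mul_mul_comm, ← sq, mul_lt_mul_iff_right₀ (pow_pos hc 2)]

/-- The maximum of `a` exceeds the level, since the mean of `a` with respect to itself does. -/
theorem support_upperPart_nonempty {a : X →₀ ℝ} (ha : ∀ x, 0 ≤ a x) (h0 : a ≠ 0) :
    (upperPart a).support.Nonempty := by
  by_contra hne
  have hle : ∀ x, a x * a.degree ≤ halfNormSq a := fun x =>
    not_lt.1 fun h => hne ⟨x, mem_support_upperPart.2 h⟩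
  have hpos := halfNormSq_pos h0
  have hd : 0 < a.degree := by
    rw [Finsupp.degree_apply]
    exact Finset.sum_pos (fun x hx => (ha x).lt_of_ne' (Finsupp.mem_support_iff.1 hx))
      (Finsupp.support_nonempty_iff.2 h0)
  have h : ∑ x ∈ a.support, a x * (a x * a.degree) ≤ ∑ x ∈ a.support, a x * halfNormSq a :=
    Finset.sum_le_sum fun x _ => mul_le_mul_of_nonneg_left (hle x) (ha x)
  have h1 : ∑ x ∈ a.support, a x * (a x * a.degree) = 2 * halfNormSq a * a.degree := by
    rw [halfNormSq, mul_div_cancel₀ _ two_ne_zero, Finsupp.sum, Finset.sum_mul]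
    exact Finset.sum_congr rfl fun x _ => by ring
  rw [h1, ← Finset.sum_mul, ← Finsupp.degree_apply] at h
  nlinarith

/-- The weight of the finite set `A` with respect to the nonnegative function `a`. It is positive
if and only if `A` is contained in the support of `a` and the mass of `a` outside of `A` is below
the level `halfNormSq a`. -/
noncomputable def levelWeight (a : X →₀ ℝ) (A : Finset X) : ℝ :=
  (∏ x ∈ A, a x) * max 0 (halfNormSq a - (a.degree - ∑ x ∈ A, a x))

theorem levelWeight_nonneg {a : X →₀ ℝ} (ha : ∀ x, 0 ≤ a x) (A : Finset X) :
    0 ≤ levelWeight a A :=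
  mul_nonneg (Finset.prod_nonneg fun x _ => ha x) (le_max_left _ _)

theorem subset_support_of_levelWeight_ne_zero {a : X →₀ ℝ} {A : Finset X}
    (h : levelWeight a A ≠ 0) : A ⊆ a.support := fun x hx =>
  Finsupp.mem_support_iff.2 fun h0 => h (by rw [levelWeight, Finset.prod_eq_zero hx h0, zero_mul])

theorem levelWeight_support_pos {a : X →₀ ℝ} (ha : ∀ x, 0 ≤ a x) (h0 : a ≠ 0) :
    0 < levelWeight a a.support := by
  rw [levelWeight, Finsupp.degree_apply, sub_self, sub_zero,
    max_eq_right (halfNormSq_nonneg a)]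
  exact mul_pos (Finset.prod_pos fun x hx => (ha x).lt_of_ne' (Finsupp.mem_support_iff.1 hx))
    (halfNormSq_pos h0)

/-- A point above the level outside of `A` would alone have too much mass. -/
theorem support_upperPart_subset_of_levelWeight_ne_zero {a : X →₀ ℝ} (ha : ∀ x, 0 ≤ a x)
    (h1 : a.degree = 1) {A : Finset X} (h : levelWeight a A ≠ 0) :
    (upperPart a).support ⊆ A := by
  classical
  intro x hx
  by_contra hxA
  rw [mem_support_upperPart, h1, mul_one] at hx
  have h2 : halfNormSq a - (a.degree - ∑ x ∈ A, a x) > 0 := by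
    by_contra hle
    exact h (by rw [levelWeight, max_eq_left (not_lt.1 hle), mul_zero])
  have h3 := Finsupp.sum_le_degree_of_nonneg ha (A := insert x A)
  rw [Finset.sum_insert hxA] at h3
  linarith

/-- The sum of the points `y A` over the subsets `A` of the support of `a`, weighted by
`levelWeight a A`. If `a` has total mass `1`, only sets `A` that contain all points above the level
contribute. -/
noncomputable def lowerPart (y : Finset X → Y) (a : X →₀ ℝ) : Y →₀ ℝ :=
  ∑ A ∈ a.support.powerset, Finsupp.single (y A) (levelWeight a A)

theorem lowerPart_eq_sum (y : Finset X → Y) {a : X →₀ ℝ} {S : Finset X} (hS : a.support ⊆ S) :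
    lowerPart y a = ∑ A ∈ S.powerset, Finsupp.single (y A) (levelWeight a A) := by
  refine Finset.sum_subset (Finset.powerset_mono.2 hS) fun A _ hA => ?_
  rw [Finset.mem_powerset] at hA
  rw [not_imp_comm.1 subset_support_of_levelWeight_ne_zero hA, Finsupp.single_zero]

theorem lowerPart_apply (y : Finset X → Y) {a : X →₀ ℝ} {S : Finset X} (hS : a.support ⊆ S)
    (z : Y) : lowerPart y a z = ∑ A ∈ S.powerset, Finsupp.single (y A) (levelWeight a A) z := by
  rw [lowerPart_eq_sum y hS, Finsupp.finsetSum_apply]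

theorem single_nonneg_apply {z w : Y} {r : ℝ} (hr : 0 ≤ r) : 0 ≤ Finsupp.single z r w := by
  classical
  rw [Finsupp.single_apply]
  split_ifs <;> simp [hr]

theorem lowerPart_nonneg (y : Finset X → Y) {a : X →₀ ℝ} (ha : ∀ x, 0 ≤ a x) (z : Y) :
    0 ≤ lowerPart y a z := by
  rw [lowerPart_apply y Finset.Subset.rfl]
  exact Finset.sum_nonneg fun A _ => single_nonneg_apply (levelWeight_nonneg ha A)

theorem exists_of_mem_support_lowerPart {y : Finset X → Y} {a : X →₀ ℝ} {z : Y}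
    (hz : z ∈ (lowerPart y a).support) : ∃ A, levelWeight a A ≠ 0 ∧ y A = z := by
  rw [Finsupp.mem_support_iff, lowerPart_apply y Finset.Subset.rfl] at hz
  obtain ⟨A, -, hA⟩ := Finset.exists_ne_zero_of_sum_ne_zero hz
  by_cases h : y A = z
  · subst h
    exact ⟨A, by simpa using hA, rfl⟩
  · exact absurd (Finsupp.single_eq_of_ne' h) hA

theorem support_lowerPart_nonempty (y : Finset X → Y) {a : X →₀ ℝ} (ha : ∀ x, 0 ≤ a x)
    (h0 : a ≠ 0) : (lowerPart y a).support.Nonempty := by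
  refine ⟨y a.support, Finsupp.mem_support_iff.2 (ne_of_gt ?_)⟩
  rw [lowerPart_apply y Finset.Subset.rfl]
  refine Finset.sum_pos' (fun A _ => single_nonneg_apply (levelWeight_nonneg ha A))
    ⟨a.support, Finset.mem_powerset_self _, ?_⟩
  rw [Finsupp.single_eq_same]
  exact levelWeight_support_pos ha h0

end Levels

/-! ### The two complexes of a relation -/

namespace PreAbstractSimplicialComplex

variable {X Y : Type*}

/-- The Dowker complex of a relation: its simplices are the nonempty finite sets of points that are
all related to a common point. -/
def dowkerComplex (R : X → Y → Prop) : PreAbstractSimplicialComplex X where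
  faces := {s | s.Nonempty ∧ ∃ y, ∀ x ∈ s, R x y}
  isRelLowerSet_faces := fun _ hs =>
    ⟨hs.1, fun _ hts ht => ⟨ht, hs.2.imp fun _ hy x hx => hy x (hts hx)⟩⟩

/-- The biclique complex of a relation: its simplices are the nonempty finite sets `A ⊔ B` in which
every point of `A` is related to every point of `B`; here `A` or `B` may be empty. -/
def bicliqueComplex (R : X → Y → Prop) : PreAbstractSimplicialComplex (X ⊕ Y) where
  faces := {s | s.Nonempty ∧ ∀ x y, Sum.inl x ∈ s → Sum.inr y ∈ s → R x y}
  isRelLowerSet_faces := fun _ hs =>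
    ⟨hs.1, fun _ hts ht => ⟨ht, fun x y hx hy => hs.2 x y (hts hx) (hts hy)⟩⟩

variable {R : X → Y → Prop}

theorem Realization.ne_zero {K : PreAbstractSimplicialComplex X} (p : K.Realization) : p.1 ≠ 0 :=
  fun h => by simpa [h] using p.degree_eq_one

theorem upperPart_mem_cone {K : PreAbstractSimplicialComplex X} (p : K.Realization) :
    upperPart p.1 ∈ K.cone :=
  ⟨upperPart_nonneg _, K.mem_faces_of_subset p.support_mem_faces (support_upperPart_subset _)
    (support_upperPart_nonempty p.nonneg p.ne_zero)⟩

theorem continuous_halfNormSq {K : PreAbstractSimplicialComplex X} :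
    Continuous fun p : K.Realization => halfNormSq p.1 := by
  let := finiteTopology X
  exact ((continuous_finsuppSum (c := fun _ r => r ^ 2) (fun _ => continuous_pow 2)
    (by simp)).comp Realization.isInducing_val.continuous).div_const 2

theorem continuous_upperPart_apply {K : PreAbstractSimplicialComplex X} (x : X) :
    Continuous fun p : K.Realization => upperPart p.1 x := by
  simp only [upperPart_apply, Realization.degree_eq_one]
  exact continuous_const.max (((Realization.continuous_apply x).mul continuous_const).sub
    continuous_halfNormSq)

/-- On a closed simplex the sum that defines the lower part runs over a fixed finite family. -/
theorem continuousOn_lowerPart_apply {K : PreAbstractSimplicialComplex X} (y : Finset X → Y)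
    (s : Finset X) (z : Y) : ContinuousOn (fun p : K.Realization => lowerPart y p.1 z)
      (Realization.closedSimplex K s) := by
  classical
  have h2 : ∀ A, Continuous fun p : K.Realization => levelWeight p.1 A := fun A => by
    simp only [levelWeight, Realization.degree_eq_one]
    exact (continuous_finsetProd _ fun x _ => Realization.continuous_apply x).mul
      (continuous_const.max (continuous_halfNormSq.sub (continuous_const.sub
        (continuous_finsetSum _ fun x _ => Realization.continuous_apply x))))
  have h3 : Continuous fun p : K.Realization =>
      ∑ A ∈ s.powerset, Finsupp.single (y A) (levelWeight p.1 A) z := by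
    refine continuous_finsetSum _ fun A _ => ?_
    simp only [Finsupp.single_apply]
    split_ifs
    exacts [h2 A, continuous_const]
  exact h3.continuousOn.congr fun p hp => lowerPart_apply y hp z

/-- The points above the level are related to all the points of the lower part, provided that
`y A` is a common neighbour of each simplex `A`. -/
theorem rel_of_mem_support_upperPart_lowerPart {y : Finset X → Y}
    (hy : ∀ A ∈ (dowkerComplex R).faces, ∀ x ∈ A, R x (y A)) (p : (dowkerComplex R).Realization)
    {x : X} (hx : x ∈ (upperPart p.1).support) {z : Y} (hz : z ∈ (lowerPart y p.1).support) :
    R x z := by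
  obtain ⟨A, hA, rfl⟩ := exists_of_mem_support_lowerPart hz
  have hxA := support_upperPart_subset_of_levelWeight_ne_zero p.nonneg p.degree_eq_one hA hx
  exact hy A (mem_faces_of_subset _ p.support_mem_faces (subset_support_of_levelWeight_ne_zero hA)
    ⟨x, hxA⟩) x hxA

end PreAbstractSimplicialComplex

/-! ### Functions on a disjoint union -/

section SumFunctions

variable {X Y : Type*}

/-- The restriction of a finitely supported function on `X ⊕ Y` to `X`. -/
noncomputable def leftPart (z : X ⊕ Y →₀ ℝ) : X →₀ ℝ :=
  z.comapDomain Sum.inl Sum.inl_injective.injOn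

/-- The restriction of a finitely supported function on `X ⊕ Y` to `Y`. -/
noncomputable def rightPart (z : X ⊕ Y →₀ ℝ) : Y →₀ ℝ :=
  z.comapDomain Sum.inr Sum.inr_injective.injOn

theorem leftPart_apply (z : X ⊕ Y →₀ ℝ) (x : X) : leftPart z x = z (Sum.inl x) := rfl

theorem rightPart_apply (z : X ⊕ Y →₀ ℝ) (y : Y) : rightPart z y = z (Sum.inr y) := rfl

theorem mem_support_leftPart {z : X ⊕ Y →₀ ℝ} {x : X} :
    x ∈ (leftPart z).support ↔ Sum.inl x ∈ z.support := by
  rw [Finsupp.mem_support_iff, Finsupp.mem_support_iff, leftPart_apply]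

theorem mem_support_rightPart {z : X ⊕ Y →₀ ℝ} {y : Y} :
    y ∈ (rightPart z).support ↔ Sum.inr y ∈ z.support := by
  rw [Finsupp.mem_support_iff, Finsupp.mem_support_iff, rightPart_apply]

theorem Finsupp.degree_sumElim (a : X →₀ ℝ) (b : Y →₀ ℝ) :
    (a.sumElim b).degree = a.degree + b.degree := by
  rw [Finsupp.sumElim_eq_add, map_add, Finsupp.degree_mapDomain, Finsupp.degree_mapDomain]

theorem degree_leftPart_add_degree_rightPart (z : X ⊕ Y →₀ ℝ) :
    (leftPart z).degree + (rightPart z).degree = z.degree := by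
  rw [← Finsupp.degree_sumElim]
  exact congrArg _ (Finsupp.comapDomain_sumElim_comapDomain z)

theorem Finsupp.degree_eq_zero_of_apply {a : X →₀ ℝ} (h : ∀ x, a x = 0) : a.degree = 0 := by
  rw [show a = 0 from Finsupp.ext h, map_zero]

theorem Finsupp.degree_nonneg_of_nonneg {a : X →₀ ℝ} (h : ∀ x, 0 ≤ a x) : 0 ≤ a.degree :=
  Finset.sum_nonneg fun x _ => h x

end SumFunctions

/-! ### Cutting off the part below the level -/

namespace PreAbstractSimplicialComplex

variable {X Y : Type*} {R : X → Y → Prop}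

theorem normalize_smul {K : PreAbstractSimplicialComplex X} {P : X →₀ ℝ} (hP : P ∈ K.cone) {c : ℝ}
    (hc : 0 < c) (h : c • P ∈ K.cone) : normalize (c • P) h = normalize P hP := by
  refine Subtype.ext ?_
  change (c • P).degree⁻¹ • c • P = P.degree⁻¹ • P
  rw [Finsupp.degree_smul_real, smul_smul, mul_inv, mul_right_comm, inv_mul_cancel₀ hc.ne', one_mul]

/-- The map of the realization to itself that cuts off the part below the level. -/
noncomputable def upperMap (K : PreAbstractSimplicialComplex X) :
    C(K.Realization, K.Realization) where
  toFun p := normalize (upperPart p.1) (upperPart_mem_cone p)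
  continuous_toFun := Realization.continuous_of_closedSimplex fun s _ =>
    Realization.continuousOn_of_eq_normalization s
      (fun p hp => (support_upperPart_subset p.1).trans hp)
      (fun x _ => (continuous_upperPart_apply x).continuousOn) fun _ _ => rfl

theorem upperMap_homotopic_id (K : PreAbstractSimplicialComplex X) :
    (upperMap K).Homotopic (ContinuousMap.id _) :=
  Realization.homotopic_of_common_face _ _ fun p =>
    ⟨p.1.support, p.support_mem_faces,
      (support_normalize (upperPart_mem_cone p)).trans_subset (support_upperPart_subset p.1),
      Finset.Subset.rfl⟩

/-! ### From the suspension to the biclique complex -/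

/-- The path that leads, for `t` from `0` to `1`, from the vertex `x₀` through the upper part of `a`
(at `t = 1 / 3`) and the lower part of `a` (at `t = 2 / 3`) to the vertex `y₀`, all up to positive
factors. Left and right coordinates are both nonzero only for `1 / 3 < t < 2 / 3`, where neither
`x₀` nor `y₀` contributes. -/
noncomputable def pathPoint (x₀ : X) (y₀ : Y) (y : Finset X → Y) (a : X →₀ ℝ) (t : ℝ) :
    X ⊕ Y →₀ ℝ :=
  Finsupp.sumElim (Finsupp.single x₀ (max 0 (1 - 3 * t)) + max 0 (min t (2 / 3 - t)) • upperPart a)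
    (max 0 (min (t - 1 / 3) (1 - t)) • lowerPart y a + Finsupp.single y₀ (max 0 (3 * t - 2)))

section pathPoint

variable {x₀ : X} {y₀ : Y} {y : Finset X → Y} {a : X →₀ ℝ} {t : ℝ}

theorem pathPoint_inl (x : X) : pathPoint x₀ y₀ y a t (Sum.inl x) =
    Finsupp.single x₀ (max 0 (1 - 3 * t)) x + max 0 (min t (2 / 3 - t)) * upperPart a x := rfl

theorem pathPoint_inr (z : Y) : pathPoint x₀ y₀ y a t (Sum.inr z) =
    max 0 (min (t - 1 / 3) (1 - t)) * lowerPart y a z +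
      Finsupp.single y₀ (max 0 (3 * t - 2)) z := rfl

theorem pathPoint_nonneg (ha : ∀ x, 0 ≤ a x) (v : X ⊕ Y) : 0 ≤ pathPoint x₀ y₀ y a t v := by
  rcases v with x | z
  · exact add_nonneg (single_nonneg_apply (le_max_left _ _))
      (mul_nonneg (le_max_left _ _) (upperPart_nonneg a x))
  · exact add_nonneg (mul_nonneg (le_max_left _ _) (lowerPart_nonneg y ha z))
      (single_nonneg_apply (le_max_left _ _))

theorem of_pathPoint_inl_ne_zero {x : X} (h : pathPoint x₀ y₀ y a t (Sum.inl x) ≠ 0) :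
    t < 2 / 3 ∧ (t < 1 / 3 ∨ x ∈ (upperPart a).support) := by
  rw [pathPoint_inl] at h
  by_cases ht : t < 1 / 3
  · exact ⟨by linarith, Or.inl ht⟩
  rw [max_eq_left (by linarith : 1 - 3 * t ≤ 0), Finsupp.single_zero, Finsupp.zero_apply,
    zero_add] at h
  refine ⟨?_, Or.inr (Finsupp.mem_support_iff.2 (right_ne_zero_of_mul h))⟩
  by_contra ht'
  exact h (by rw [max_eq_left ((min_le_right _ _).trans (by linarith)), zero_mul])

theorem of_pathPoint_inr_ne_zero {z : Y} (h : pathPoint x₀ y₀ y a t (Sum.inr z) ≠ 0) :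
    1 / 3 < t ∧ (2 / 3 < t ∨ z ∈ (lowerPart y a).support) := by
  rw [pathPoint_inr] at h
  by_cases ht : 2 / 3 < t
  · exact ⟨by linarith, Or.inl ht⟩
  rw [max_eq_left (by linarith : 3 * t - 2 ≤ 0), Finsupp.single_zero, Finsupp.zero_apply,
    add_zero] at h
  refine ⟨?_, Or.inr (Finsupp.mem_support_iff.2 (right_ne_zero_of_mul h))⟩
  by_contra ht'
  exact h (by rw [max_eq_left ((min_le_left _ _).trans (by linarith)), zero_mul])

theorem pathPoint_zero : pathPoint x₀ y₀ y a 0 = Finsupp.single (Sum.inl x₀) 1 := by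
  simp [pathPoint]

theorem pathPoint_one : pathPoint x₀ y₀ y a 1 = Finsupp.single (Sum.inr y₀) 1 := by
  simp [pathPoint]
  norm_num

theorem pathPoint_support_nonempty (ha : ∀ x, 0 ≤ a x) (h0 : a ≠ 0) (ht0 : 0 ≤ t) (ht1 : t ≤ 1) :
    (pathPoint x₀ y₀ y a t).support.Nonempty := by
  rcases ht0.eq_or_lt with rfl | ht0
  · exact ⟨Sum.inl x₀, by simp [pathPoint_zero]⟩
  rcases ht1.eq_or_lt with rfl | ht1
  · exact ⟨Sum.inr y₀, by simp [pathPoint_one]⟩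
  rcases lt_or_ge t (2 / 3) with ht | ht
  · obtain ⟨x, hx⟩ := support_upperPart_nonempty ha h0
    refine ⟨Sum.inl x, Finsupp.mem_support_iff.2 (ne_of_gt ?_)⟩
    rw [pathPoint_inl]
    exact add_pos_of_nonneg_of_pos (single_nonneg_apply (le_max_left _ _))
      (mul_pos (lt_max_of_lt_right (lt_min ht0 (by linarith)))
        ((upperPart_nonneg a x).lt_of_ne' (Finsupp.mem_support_iff.1 hx)))
  · obtain ⟨z, hz⟩ := support_lowerPart_nonempty y ha h0
    refine ⟨Sum.inr z, Finsupp.mem_support_iff.2 (ne_of_gt ?_)⟩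
    rw [pathPoint_inr]
    exact add_pos_of_pos_of_nonneg (mul_pos (lt_max_of_lt_right (lt_min (by linarith)
      (by linarith))) ((lowerPart_nonneg y ha z).lt_of_ne' (Finsupp.mem_support_iff.1 hz)))
      (single_nonneg_apply (le_max_left _ _))

theorem pathPoint_mem_cone (hy : ∀ A ∈ (dowkerComplex R).faces, ∀ x ∈ A, R x (y A))
    (p : (dowkerComplex R).Realization) (t : unitInterval) :
    pathPoint x₀ y₀ y p.1 t ∈ (bicliqueComplex R).cone := by
  refine ⟨pathPoint_nonneg p.nonneg,
    pathPoint_support_nonempty p.nonneg p.ne_zero t.2.1 t.2.2, fun x z hx hz => ?_⟩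
  obtain ⟨h1, h2⟩ := of_pathPoint_inl_ne_zero (Finsupp.mem_support_iff.1 hx)
  obtain ⟨h3, h4⟩ := of_pathPoint_inr_ne_zero (Finsupp.mem_support_iff.1 hz)
  exact rel_of_mem_support_upperPart_lowerPart hy p (h2.resolve_left (by linarith))
    (h4.resolve_left (by linarith))

end pathPoint

section Equivalence

variable (x₀ : X) (y₀ : Y) (y : Finset X → Y)
  (hy : ∀ A ∈ (dowkerComplex R).faces, ∀ x ∈ A, R x (y A))

/-- The map from the cylinder over the Dowker complex to the biclique complex that is given by
`pathPoint`. -/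
noncomputable def cylinderMap :
    C((dowkerComplex R).Realization × unitInterval, (bicliqueComplex R).Realization) where
  toFun q := normalize (pathPoint x₀ y₀ y q.1.1 q.2) (pathPoint_mem_cone hy q.1 q.2)
  continuous_toFun := by
    classical
    refine Realization.continuous_of_closedSimplex_prod fun s _ =>
      Realization.continuousOn_of_eq_normalization
        ((insert x₀ s).disjSum (insert y₀ (s.powerset.image y))) (fun q hq v hv => ?_)
        (fun v _ => ?_) fun _ _ => rfl
    · have hq1 : q.1.1.support ⊆ s := hq.1
      rw [Finsupp.mem_support_iff] at hv
      rcases v with x | z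
      · rw [Finset.inl_mem_disjSum, Finset.mem_insert]
        by_contra! hx
        rw [pathPoint_inl, Finsupp.single_eq_of_ne hx.1, zero_add] at hv
        exact hx.2 (hq1 (support_upperPart_subset _
          (Finsupp.mem_support_iff.2 (right_ne_zero_of_mul hv))))
      · rw [Finset.inr_mem_disjSum, Finset.mem_insert, Finset.mem_image]
        by_contra! hz
        rw [pathPoint_inr, Finsupp.single_eq_of_ne hz.1, add_zero] at hv
        obtain ⟨A, hA, rfl⟩ := exists_of_mem_support_lowerPart
          (Finsupp.mem_support_iff.2 (right_ne_zero_of_mul hv))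
        exact hz.2 A (Finset.mem_powerset.2
          ((subset_support_of_levelWeight_ne_zero hA).trans hq1)) rfl
    · rcases v with x | z
      · simp only [pathPoint_inl]
        refine Continuous.continuousOn (.add ?_ (.mul (by fun_prop)
          ((continuous_upperPart_apply x).comp continuous_fst)))
        simp only [Finsupp.single_apply]
        split_ifs <;> fun_prop
      · simp only [pathPoint_inr]
        refine .add (.mul (Continuous.continuousOn (by fun_prop))
          ((continuousOn_lowerPart_apply y s z).comp continuousOn_fst fun q hq => hq.1))
          (Continuous.continuousOn ?_)
        simp only [Finsupp.single_apply]
        split_ifs <;> fun_prop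

theorem cylinderMap_apply (q : (dowkerComplex R).Realization × unitInterval) :
    cylinderMap x₀ y₀ y hy q =
      normalize (pathPoint x₀ y₀ y q.1.1 q.2) (pathPoint_mem_cone hy q.1 q.2) := rfl

theorem support_cylinderMap (q : (dowkerComplex R).Realization × unitInterval) :
    (cylinderMap x₀ y₀ y hy q).1.support = (pathPoint x₀ y₀ y q.1.1 q.2).support :=
  support_normalize (pathPoint_mem_cone hy q.1 q.2)

end Equivalence

/-! ### From the biclique complex to the suspension -/

namespace Realization

variable (p₀ : (dowkerComplex R).Realization) (z : (bicliqueComplex R).Realization)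

theorem leftPart_nonneg (x : X) : 0 ≤ leftPart z.1 x := z.nonneg _

theorem rightPart_nonneg (y : Y) : 0 ≤ rightPart z.1 y := z.nonneg _

theorem degree_leftPart_add : (leftPart z.1).degree + (rightPart z.1).degree = 1 := by
  rw [degree_leftPart_add_degree_rightPart, z.degree_eq_one]

/-- The height of a point of the biclique complex: twice the mass of its right part, cut off
at `1`. -/
noncomputable def height : unitInterval :=
  ⟨min 1 (2 * (rightPart z.1).degree), le_min zero_le_one
    (mul_nonneg zero_le_two (Finsupp.degree_nonneg_of_nonneg (rightPart_nonneg z))),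
    min_le_left _ _⟩

theorem coe_height : (height z : ℝ) = min 1 (2 * (rightPart z.1).degree) := rfl

theorem continuous_degree_rightPart :
    Continuous fun z : (bicliqueComplex R).Realization => (rightPart z.1).degree := by
  let := finiteTopology (X ⊕ Y)
  let c : X ⊕ Y → ℝ → ℝ := Sum.elim (fun _ _ => 0) fun _ r => r
  have h : ∀ w : X ⊕ Y →₀ ℝ, (rightPart w).degree = w.sum c := fun w => by
    rw [← Finsupp.comapDomain_sumElim_comapDomain w, Finsupp.sum_sumElim]
    simp [Finsupp.sum, c, Finsupp.degree_apply, rightPart]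
  simp only [h]
  refine (continuous_finsuppSum ?_ ?_).comp isInducing_val.continuous
  · rintro (x | y)
    exacts [continuous_const, continuous_id]
  · rintro (x | y) <;> rfl

theorem continuous_height :
    Continuous (height : (bicliqueComplex R).Realization → unitInterval) :=
  Continuous.subtype_mk (continuous_const.min (continuous_const.mul continuous_degree_rightPart)) _

open Classical in
/-- The direction of the left part of a point of the biclique complex. It is a point of the Dowker
complex unless the left or the right part vanishes; the point `p₀` is taken as the value if it is
not. -/
noncomputable def leftDirection : (dowkerComplex R).Realization :=
  if h : leftPart z.1 ∈ (dowkerComplex R).cone then normalize _ h else p₀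

variable {z}

theorem leftDirection_eq (h : leftPart z.1 ∈ (dowkerComplex R).cone) :
    leftDirection p₀ z = normalize _ h := dif_pos h

theorem leftPart_mem_cone (hl : (leftPart z.1).degree ≠ 0) {s : Finset (X ⊕ Y)}
    (hs : s ∈ (bicliqueComplex R).faces) (hz : z ∈ closedSimplex _ s) {y : Y} (hy : Sum.inr y ∈ s) :
    leftPart z.1 ∈ (dowkerComplex R).cone := by
  refine ⟨leftPart_nonneg z, ?_, y, fun x hx =>
    hs.2 x y (hz (mem_support_leftPart.1 hx)) hy⟩
  rw [Finsupp.support_nonempty_iff]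
  rintro h
  simp [h] at hl

end Realization

end PreAbstractSimplicialComplex

/-! ### Suspensions -/

namespace Suspension

variable {A Z : Type*}

/-- The quotient map from the cylinder to the suspension. -/
def mk (q : A × unitInterval) : Suspension A := Quot.mk _ (Sum.inl q)

theorem mk_zero (p q : A) : mk (p, 0) = mk (q, 0) :=
  (Quot.sound (.zero p)).trans (Quot.sound (.zero q)).symm

theorem mk_one (p q : A) : mk (p, 1) = mk (q, 1) :=
  (Quot.sound (.one p)).trans (Quot.sound (.one q)).symm

theorem mk_surjective [Nonempty A] :
    Function.Surjective (mk : A × unitInterval → Suspension A) := by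
  inhabit A
  rintro ⟨q | _ | _⟩
  · exact ⟨q, rfl⟩
  · exact ⟨(default, 0), Quot.sound (.zero default)⟩
  · exact ⟨(default, 1), Quot.sound (.one default)⟩

variable [TopologicalSpace A] [TopologicalSpace Z]

theorem continuous_mk : Continuous (mk : A × unitInterval → Suspension A) :=
  continuous_quot_mk.comp continuous_inl

/-- The suspension of a nonempty space is a quotient of the cylinder alone. -/
theorem isQuotientMap_mk [Nonempty A] :
    IsQuotientMap (mk : A × unitInterval → Suspension A) := by
  refine ⟨isCoinducing_iff.2 fun s => ⟨fun hs => ?_, fun hs => hs.preimage continuous_mk⟩,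
    mk_surjective⟩
  exact isOpen_coinduced.2 (isOpen_sum_iff.2 ⟨hs, isOpen_discrete _⟩)

/-- The map from the suspension that is induced by a map from the cylinder which is constant on both
ends. -/
def lift (f : C(A × unitInterval, Z)) (p₀ : A) (h0 : ∀ p, f (p, 0) = f (p₀, 0))
    (h1 : ∀ p, f (p, 1) = f (p₀, 1)) : C(Suspension A, Z) where
  toFun := Quot.lift (Sum.elim f fun b => f (p₀, if b then 1 else 0)) (by
    rintro _ _ (p | p)
    exacts [h0 p, h1 p])
  continuous_toFun := continuous_quot_lift _ (f.continuous.sumElim continuous_of_discreteTopology)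

/-- A self-map of the suspension that is, in cylinder coordinates, `φ` on the base and some
function `τ` on the height is homotopic to the identity if `φ` is and `τ` fixes both ends. -/
theorem homotopic_id [Nonempty A] {k : C(Suspension A, Suspension A)} {φ : C(A, A)}
    (hφ : φ.Homotopic (ContinuousMap.id A)) {τ : A × unitInterval → unitInterval}
    (hτ : Continuous τ) (h0 : ∀ p, τ (p, 0) = 0) (h1 : ∀ p, τ (p, 1) = 1)
    (hk : ∀ q, k (mk q) = mk (φ q.1, τ q)) : k.Homotopic (ContinuousMap.id _) := by
  obtain ⟨F⟩ := hφ
  let p₀ : A := Classical.arbitrary A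
  let σ : (A × unitInterval) × unitInterval → unitInterval := fun w =>
    ⟨(1 - (w.2 : ℝ)) * τ w.1 + w.2 * w.1.2, by
      exact add_nonneg (mul_nonneg (sub_nonneg.2 w.2.2.2) (τ w.1).2.1)
        (mul_nonneg w.2.2.1 w.1.2.2.1), by
      nlinarith [w.2.2.1, w.2.2.2, (τ w.1).2.2, w.1.2.2.2,
        mul_nonneg (sub_nonneg.2 w.2.2.2) (sub_nonneg.2 (τ w.1).2.2),
        mul_nonneg w.2.2.1 (sub_nonneg.2 w.1.2.2.2)]⟩
  have hσ : Continuous σ := by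
    refine Continuous.subtype_mk ?_ _
    fun_prop
  let G : (A × unitInterval) × unitInterval → Suspension A := fun w => mk (F (w.2, w.1.1), σ w)
  have hG : Continuous G := continuous_mk.comp
    ((F.continuous.comp (by fun_prop : Continuous fun w : (A × unitInterval) × unitInterval =>
      (w.2, w.1.1))).prodMk hσ)
  have hG0 : ∀ p u, G ((p, 0), u) = G ((p₀, 0), u) := fun p u => by
    have : ∀ p, σ ((p, 0), u) = 0 := fun p => Subtype.ext (by simp [σ, h0])
    simp only [G, this]
    exact mk_zero _ _
  have hG1 : ∀ p u, G ((p, 1), u) = G ((p₀, 1), u) := fun p u => by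
    have : ∀ p, σ ((p, 1), u) = 1 := fun p => Subtype.ext (by simp [σ, h1])
    simp only [G, this]
    exact mk_one _ _
  let H : Suspension A × unitInterval → Suspension A := fun w =>
    Quot.lift (Sum.elim (fun q => G (q, w.2)) fun b => G ((p₀, if b then 1 else 0), w.2)) (by
      rintro _ _ (p | p)
      exacts [hG0 p w.2, hG1 p w.2]) w.1
  have hH : Continuous H := isQuotientMap_mk.continuous_lift_prod_left hG
  refine ⟨{
    toFun := fun w => H w.swap
    continuous_toFun := hH.comp continuous_swap
    map_zero_left := fun x => ?_
    map_one_left := fun x => ?_ }⟩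
  · obtain ⟨q, rfl⟩ := mk_surjective x
    rw [hk]
    change mk (F (0, q.1), σ (q, 0)) = _
    rw [F.apply_zero]
    exact congrArg mk (Prod.ext rfl (Subtype.ext (by simp [σ])))
  · obtain ⟨q, rfl⟩ := mk_surjective x
    change mk (F (1, q.1), σ (q, 1)) = mk q
    rw [F.apply_one]
    exact congrArg mk (Prod.ext rfl (Subtype.ext (by simp [σ])))

end Suspension

/-! ### The homotopy equivalence -/

namespace PreAbstractSimplicialComplex

open Realization

variable {X Y : Type*} {R : X → Y → Prop}

section Equivalence

variable (p₀ : (dowkerComplex R).Realization)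

/-- The map from the biclique complex to the suspension of the Dowker complex with the direction
of the left part and the height as cylinder coordinates. -/
noncomputable def toSuspension :
    C((bicliqueComplex R).Realization, Suspension (dowkerComplex R).Realization) where
  toFun z := Suspension.mk (leftDirection p₀ z, height z)
  continuous_toFun := by
    classical
    refine continuous_of_closedSimplex fun s hs => ?_
    by_cases hy : ∃ y : Y, Sum.inr y ∈ s
    · obtain ⟨y, hy⟩ := hy
      -- The direction is continuous where the mass of the left part is at least `1 / 2`.
      -- Everything else is sent to a pole.
      have hclosed : ∀ z ∈ closedSimplex (bicliqueComplex R) s,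
          z ∈ (closedSimplex (bicliqueComplex R) s ∩ {z | (rightPart z.1).degree ≤ 1 / 2}) ∪
            {z | 1 / 2 ≤ (rightPart z.1).degree} := fun z hz =>
        (le_total (rightPart z.1).degree (1 / 2)).imp (fun h => ⟨hz, h⟩) id
      have hcs : IsClosed (closedSimplex (bicliqueComplex R) s) := by
        let := finiteTopology (X ⊕ Y)
        have : T2Space (bicliqueComplex R).Realization := T2Space.of_injective_continuous
          (f := fun p => p.1) Subtype.val_injective isInducing_val.continuous
        exact (isCompact_closedSimplex hs).isClosed
      refine ContinuousOn.mono (ContinuousOn.union_of_isClosed ?_ ?_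
        (hcs.inter (isClosed_le continuous_degree_rightPart continuous_const))
        (isClosed_le continuous_const continuous_degree_rightPart)) hclosed
      · refine Suspension.continuous_mk.comp_continuousOn
          (.prodMk ?_ continuous_height.continuousOn)
        refine continuousOn_of_eq_normalization (F := fun z => leftPart z.1) s.toLeft
          (fun z hz x hx => ?_) (fun x _ => (continuous_apply _).continuousOn) fun z hz => ?_
        · rw [Finset.mem_toLeft]
          exact hz.1 (mem_support_leftPart.1 hx)
        · have h : (rightPart z.1).degree ≤ 1 / 2 := hz.2
          have hl : (leftPart z.1).degree ≠ 0 := by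
            have := degree_leftPart_add z
            intro h0
            linarith
          rw [leftDirection_eq p₀ (leftPart_mem_cone hl hs hz.1 hy)]
          rfl
      · refine (continuousOn_const (c := Suspension.mk (p₀, 1))).congr fun z hz => ?_
        have h : height z = 1 := Subtype.ext (by
          rw [coe_height, min_eq_left]
          · rfl
          · have h : 1 / 2 ≤ (rightPart z.1).degree := hz
            linarith)
        rw [h]
        exact Suspension.mk_one _ _
    · refine (continuousOn_const (c := Suspension.mk (p₀, 0))).congr fun z hz => ?_
      have h : height z = 0 := Subtype.ext (by
        rw [coe_height, Finsupp.degree_eq_zero_of_apply fun y => ?_]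
        · simp
        · rw [rightPart_apply]
          exact Finsupp.notMem_support_iff.1 fun h => hy ⟨y, hz h⟩)
      rw [h]
      exact Suspension.mk_zero _ _

variable (x₀ : X) (y₀ : Y) (y : Finset X → Y)
  (hy : ∀ A ∈ (dowkerComplex R).faces, ∀ x ∈ A, R x (y A))

theorem cylinderMap_zero (p q : (dowkerComplex R).Realization) :
    cylinderMap x₀ y₀ y hy (p, 0) = cylinderMap x₀ y₀ y hy (q, 0) := by
  refine Subtype.ext ?_
  simp only [cylinderMap_apply, normalize, Icc.coe_zero, pathPoint_zero]

theorem cylinderMap_one (p q : (dowkerComplex R).Realization) :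
    cylinderMap x₀ y₀ y hy (p, 1) = cylinderMap x₀ y₀ y hy (q, 1) := by
  refine Subtype.ext ?_
  simp only [cylinderMap_apply, normalize, Icc.coe_one, pathPoint_one]

/-- The map from the suspension of the Dowker complex to the biclique complex that is induced by
`cylinderMap`. -/
noncomputable def ofSuspension :
    C(Suspension (dowkerComplex R).Realization, (bicliqueComplex R).Realization) :=
  Suspension.lift (cylinderMap x₀ y₀ y hy) p₀ (fun p => cylinderMap_zero x₀ y₀ y hy p p₀)
    fun p => cylinderMap_one x₀ y₀ y hy p p₀

variable {x₀ y₀ y hy}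

theorem lt_of_height_cylinderMap_ne_zero {q : (dowkerComplex R).Realization × unitInterval}
    (h : height (cylinderMap x₀ y₀ y hy q) ≠ 0) : 1 / 3 < (q.2 : ℝ) := by
  by_contra ht
  refine h (Subtype.ext ?_)
  rw [coe_height, Finsupp.degree_eq_zero_of_apply fun z => ?_]
  · simp
  · rw [rightPart_apply, ← Finsupp.notMem_support_iff, support_cylinderMap,
      Finsupp.notMem_support_iff]
    by_contra h
    exact ht (of_pathPoint_inr_ne_zero h).1

theorem lt_of_height_cylinderMap_ne_one {q : (dowkerComplex R).Realization × unitInterval}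
    (h : height (cylinderMap x₀ y₀ y hy q) ≠ 1) : (q.2 : ℝ) < 2 / 3 := by
  by_contra ht
  refine h (Subtype.ext ?_)
  have h1 : (leftPart (cylinderMap x₀ y₀ y hy q).1).degree = 0 := by
    refine Finsupp.degree_eq_zero_of_apply fun x => ?_
    rw [leftPart_apply, ← Finsupp.notMem_support_iff, support_cylinderMap,
      Finsupp.notMem_support_iff]
    by_contra h
    exact ht (of_pathPoint_inl_ne_zero h).1
  have h2 := degree_leftPart_add (cylinderMap x₀ y₀ y hy q)
  rw [coe_height, min_eq_left]
  · rfl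
  · linarith

theorem toSuspension_cylinderMap (q : (dowkerComplex R).Realization × unitInterval) :
    toSuspension p₀ (cylinderMap x₀ y₀ y hy q) =
      Suspension.mk (upperMap _ q.1, height (cylinderMap x₀ y₀ y hy q)) := by
  change Suspension.mk (leftDirection p₀ _, _) = _
  by_cases h0 : height (cylinderMap x₀ y₀ y hy q) = 0
  · rw [h0]
    exact Suspension.mk_zero _ _
  by_cases h1 : height (cylinderMap x₀ y₀ y hy q) = 1
  · rw [h1]
    exact Suspension.mk_one _ _
  have ht0 := lt_of_height_cylinderMap_ne_zero h0
  have ht1 := lt_of_height_cylinderMap_ne_one h1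
  obtain ⟨c, hc, hl⟩ : ∃ c : ℝ, 0 < c ∧
      leftPart (cylinderMap x₀ y₀ y hy q).1 = c • upperPart q.1.1 := by
    refine ⟨(pathPoint x₀ y₀ y q.1.1 q.2).degree⁻¹ * max 0 (min (q.2 : ℝ) (2 / 3 - q.2)),
      mul_pos (inv_pos.2 (degree_pos_of_mem_cone (pathPoint_mem_cone hy q.1 q.2)))
        (lt_max_of_lt_right (lt_min (by linarith) (by linarith))), Finsupp.ext fun x => ?_⟩
    have h : pathPoint x₀ y₀ y q.1.1 q.2 (Sum.inl x) =
        max 0 (min (q.2 : ℝ) (2 / 3 - q.2)) * upperPart q.1.1 x := by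
      rw [pathPoint_inl, max_eq_left (by linarith : 1 - 3 * (q.2 : ℝ) ≤ 0), Finsupp.single_zero,
        Finsupp.zero_apply, zero_add]
    change (pathPoint x₀ y₀ y q.1.1 q.2).degree⁻¹ * pathPoint x₀ y₀ y q.1.1 q.2 (Sum.inl x) = _
    rw [h, ← mul_assoc]
    rfl
  have hup := upperPart_mem_cone q.1
  have hcone : c • upperPart q.1.1 ∈ (dowkerComplex R).cone :=
    ⟨fun x => mul_nonneg hc.le (hup.1 x), by
      rw [Finsupp.support_smul_eq hc.ne']
      exact hup.2⟩
  have h : leftDirection p₀ (cylinderMap x₀ y₀ y hy q) = upperMap _ q.1 := by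
    rw [leftDirection_eq p₀ (hl ▸ hcone)]
    simp only [hl]
    exact normalize_smul hup hc hcone
  rw [h]

theorem toSuspension_comp_ofSuspension_homotopic :
    ((toSuspension p₀).comp (ofSuspension p₀ x₀ y₀ y hy)).Homotopic (ContinuousMap.id _) := by
  have : Nonempty (dowkerComplex R).Realization := ⟨p₀⟩
  refine Suspension.homotopic_id (upperMap_homotopic_id _)
    (continuous_height.comp (cylinderMap x₀ y₀ y hy).continuous) (fun p => ?_) (fun p => ?_)
    fun q => toSuspension_cylinderMap p₀ q
  · by_contra h
    have := lt_of_height_cylinderMap_ne_zero h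
    norm_num at this
  · by_contra h
    have := lt_of_height_cylinderMap_ne_one h
    norm_num at this

/-- An intermediate stage between the identity and the composite through the suspension: the left
part is cut off at its level, and it vanishes for height at least `2 / 3`, while the right part
vanishes for height at most `1 / 3`. -/
noncomputable def cutPoint (z : (bicliqueComplex R).Realization) : X ⊕ Y →₀ ℝ :=
  Finsupp.sumElim (max 0 (2 / 3 - (height z : ℝ)) • upperPart (leftPart z.1))
    (max 0 ((height z : ℝ) - 1 / 3) • rightPart z.1)

theorem of_cutPoint_inl_ne_zero {z : (bicliqueComplex R).Realization} {x : X}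
    (h : cutPoint z (Sum.inl x) ≠ 0) :
    (height z : ℝ) < 2 / 3 ∧ x ∈ (upperPart (leftPart z.1)).support := by
  change max 0 (2 / 3 - (height z : ℝ)) * upperPart (leftPart z.1) x ≠ 0 at h
  refine ⟨?_, Finsupp.mem_support_iff.2 (right_ne_zero_of_mul h)⟩
  by_contra ht
  exact left_ne_zero_of_mul h (max_eq_left (by linarith))

theorem of_cutPoint_inr_ne_zero {z : (bicliqueComplex R).Realization} {w : Y}
    (h : cutPoint z (Sum.inr w) ≠ 0) :
    1 / 3 < (height z : ℝ) ∧ Sum.inr w ∈ z.1.support := by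
  change max 0 ((height z : ℝ) - 1 / 3) * z.1 (Sum.inr w) ≠ 0 at h
  refine ⟨?_, Finsupp.mem_support_iff.2 (right_ne_zero_of_mul h)⟩
  by_contra ht
  exact left_ne_zero_of_mul h (max_eq_left (by linarith))

theorem mem_support_of_upperPart_leftPart {z : (bicliqueComplex R).Realization} {x : X}
    (hx : x ∈ (upperPart (leftPart z.1)).support) : Sum.inl x ∈ z.1.support :=
  mem_support_leftPart.1 (support_upperPart_subset _ hx)

theorem support_cutPoint_subset (z : (bicliqueComplex R).Realization) :
    (cutPoint z).support ⊆ z.1.support := by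
  rintro (x | w) h
  · exact mem_support_of_upperPart_leftPart
      (of_cutPoint_inl_ne_zero (Finsupp.mem_support_iff.1 h)).2
  · exact (of_cutPoint_inr_ne_zero (Finsupp.mem_support_iff.1 h)).2

theorem cutPoint_mem_cone (z : (bicliqueComplex R).Realization) :
    cutPoint z ∈ (bicliqueComplex R).cone := by
  have hd := degree_leftPart_add z
  refine ⟨?_, mem_faces_of_subset _ z.support_mem_faces (support_cutPoint_subset z) ?_⟩
  · rintro (x | w)
    · exact mul_nonneg (le_max_left _ _) (upperPart_nonneg _ x)
    · exact mul_nonneg (le_max_left _ _) (z.nonneg _)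
  rcases lt_or_ge (height z : ℝ) (2 / 3) with h | h
  · have h1 : 2 * (rightPart z.1).degree < 2 / 3 := by
      rw [coe_height] at h
      exact (min_lt_iff.1 h).resolve_left (by norm_num)
    obtain ⟨x, hx⟩ := support_upperPart_nonempty (leftPart_nonneg z) fun h0 => by
      rw [h0, map_zero] at hd
      linarith
    exact ⟨Sum.inl x, Finsupp.mem_support_iff.2 (mul_ne_zero
      (lt_max_of_lt_right (by linarith)).ne' (Finsupp.mem_support_iff.1 hx))⟩
  · obtain ⟨w, hw⟩ : (rightPart z.1).support.Nonempty := by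
      rw [Finsupp.support_nonempty_iff]
      intro h0
      rw [coe_height, h0, map_zero] at h
      norm_num at h
    exact ⟨Sum.inr w, Finsupp.mem_support_iff.2 (mul_ne_zero
      (lt_max_of_lt_right (by linarith)).ne' (Finsupp.mem_support_iff.1 hw))⟩

theorem continuous_upperPart_leftPart_apply (x : X) :
    Continuous fun z : (bicliqueComplex R).Realization => upperPart (leftPart z.1) x := by
  let := finiteTopology (X ⊕ Y)
  let c : X ⊕ Y → ℝ → ℝ := Sum.elim (fun _ r => r ^ 2) fun _ _ => 0
  have h : ∀ w : X ⊕ Y →₀ ℝ, halfNormSq (leftPart w) = w.sum c / 2 := fun w => by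
    rw [← Finsupp.comapDomain_sumElim_comapDomain w, Finsupp.sum_sumElim]
    simp [Finsupp.sum, c, halfNormSq, leftPart]
  have hc : Continuous fun z : (bicliqueComplex R).Realization => halfNormSq (leftPart z.1) := by
    simp only [h]
    refine ((continuous_finsuppSum ?_ ?_).comp isInducing_val.continuous).div_const 2
    · rintro (x | y)
      exacts [continuous_pow 2, continuous_const]
    · rintro (x | y)
      exacts [zero_pow two_ne_zero, rfl]
  have hd : ∀ z : (bicliqueComplex R).Realization,
      (leftPart z.1).degree = 1 - (rightPart z.1).degree := fun z => by
    linarith [degree_leftPart_add z]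
  simp only [upperPart_apply, hd]
  exact continuous_const.max (((continuous_apply (Sum.inl x)).mul
    (continuous_const.sub continuous_degree_rightPart)).sub hc)

/-- The self-map of the biclique complex that is given by `cutPoint`. -/
noncomputable def cutMap :
    C((bicliqueComplex R).Realization, (bicliqueComplex R).Realization) where
  toFun z := normalize (cutPoint z) (cutPoint_mem_cone z)
  continuous_toFun := continuous_of_closedSimplex fun s _ =>
    continuousOn_of_eq_normalization s (fun z hz => (support_cutPoint_subset z).trans hz)
      (fun v _ => by
        have h : Continuous fun z : (bicliqueComplex R).Realization => (height z : ℝ) :=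
          continuous_subtype_val.comp continuous_height
        rcases v with x | w
        · exact ((continuous_const.max (continuous_const.sub h)).mul
            (continuous_upperPart_leftPart_apply x)).continuousOn
        · exact ((continuous_const.max (h.sub continuous_const)).mul
            (continuous_apply (Sum.inr w))).continuousOn) fun _ _ => rfl

theorem support_cutMap (z : (bicliqueComplex R).Realization) :
    (cutMap z).1.support = (cutPoint z).support := support_normalize (cutPoint_mem_cone z)

theorem cutMap_homotopic_id :
    (cutMap (R := R)).Homotopic (ContinuousMap.id _) :=
  homotopic_of_common_face _ _ fun z => ⟨z.1.support, z.support_mem_faces,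
    (support_cutMap z).trans_subset (support_cutPoint_subset z), Finset.Subset.rfl⟩

theorem ofSuspension_comp_toSuspension_homotopic :
    ((ofSuspension p₀ x₀ y₀ y hy).comp (toSuspension p₀)).Homotopic (ContinuousMap.id _) := by
  classical
  refine .trans (homotopic_of_common_face _ _ fun z => ?_) cutMap_homotopic_id
  have hs : (((ofSuspension p₀ x₀ y₀ y hy).comp (toSuspension p₀)) z).1.support =
      (pathPoint x₀ y₀ y (leftDirection p₀ z).1 (height z)).support :=
    support_cylinderMap x₀ y₀ y hy (leftDirection p₀ z, height z)
  refine ⟨_ ∪ _, ⟨?_, fun x w hx hw => ?_⟩, Finset.subset_union_left, Finset.subset_union_right⟩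
  · obtain ⟨v, hv⟩ := ((bicliqueComplex R).isRelLowerSet_faces (cutMap z).support_mem_faces).1
    exact ⟨v, Finset.mem_union_right _ hv⟩
  rw [Finset.mem_union, hs, support_cutMap, Finsupp.mem_support_iff, Finsupp.mem_support_iff]
    at hx hw
  -- A left and a right vertex both occur, so the height lies strictly between `1 / 3` and `2 / 3`.
  have ht1 : (height z : ℝ) < 2 / 3 :=
    hx.elim (fun h => (of_pathPoint_inl_ne_zero h).1) fun h => (of_cutPoint_inl_ne_zero h).1
  have ht0 : 1 / 3 < (height z : ℝ) :=
    hw.elim (fun h => (of_pathPoint_inr_ne_zero h).1) fun h => (of_cutPoint_inr_ne_zero h).1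
  have hd := degree_leftPart_add z
  rw [coe_height] at ht0 ht1
  have hr1 : 2 * (rightPart z.1).degree < 2 / 3 := (min_lt_iff.1 ht1).resolve_left (by norm_num)
  have hr0 : 1 / 3 < 2 * (rightPart z.1).degree := (lt_min_iff.1 ht0).2
  obtain ⟨w', hw'⟩ : (rightPart z.1).support.Nonempty := by
    rw [Finsupp.support_nonempty_iff]
    intro h0
    rw [h0, map_zero] at hr0
    norm_num at hr0
  have hcone : leftPart z.1 ∈ (dowkerComplex R).cone :=
    leftPart_mem_cone (by intro h0; linarith) z.support_mem_faces (Finset.Subset.refl _)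
      (y := w') (mem_support_rightPart.1 hw')
  have hup : (upperPart (leftDirection p₀ z).1).support = (upperPart (leftPart z.1)).support := by
    rw [leftDirection_eq p₀ hcone]
    exact support_upperPart_smul (inv_pos.2 (degree_pos_of_mem_cone hcone)) _
  have hx' : x ∈ (upperPart (leftPart z.1)).support := by
    rcases hx with h | h
    · rw [← hup]
      refine (of_pathPoint_inl_ne_zero h).2.resolve_left ?_
      rw [not_lt]
      exact (le_of_lt (lt_min_iff.2 ⟨by norm_num, hr0⟩))
    · exact (of_cutPoint_inl_ne_zero h).2
  rcases hw with h | h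
  · refine rel_of_mem_support_upperPart_lowerPart hy (leftDirection p₀ z) (hup ▸ hx')
      ((of_pathPoint_inr_ne_zero h).2.resolve_left ?_)
    rw [not_lt]
    exact ht1.le
  · exact z.support_mem_faces.2 x w (mem_support_of_upperPart_leftPart hx')
      (of_cutPoint_inr_ne_zero h).2

end Equivalence

/-- The suspension of the Dowker complex of a nonempty relation is homotopy equivalent to its
biclique complex. -/
theorem nonempty_suspension_dowkerComplex_homotopyEquiv (hR : ∃ x y, R x y) :
    Nonempty (ContinuousMap.HomotopyEquiv (Suspension (dowkerComplex R).Realization)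
      (bicliqueComplex R).Realization) := by
  classical
  obtain ⟨x₀, y₀, h⟩ := hR
  have hex : ∀ A, ∃ y, A ∈ (dowkerComplex R).faces → ∀ x ∈ A, R x y := fun A => by
    by_cases hA : A ∈ (dowkerComplex R).faces
    · exact hA.2.imp fun _ hy _ => hy
    · exact ⟨y₀, fun h => absurd h hA⟩
  choose y hy using hex
  have hp : Finsupp.single x₀ (1 : ℝ) ∈ (dowkerComplex R).cone := by
    refine ⟨fun x => single_nonneg_apply zero_le_one, ?_⟩
    rw [Finsupp.support_single _ one_ne_zero]
    exact ⟨Finset.singleton_nonempty _, y₀, by simpa using h⟩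
  exact ⟨{
    toFun := ofSuspension (normalize _ hp) x₀ y₀ y hy
    invFun := toSuspension (normalize _ hp)
    left_inv := toSuspension_comp_ofSuspension_homotopic _
    right_inv := ofSuspension_comp_toSuspension_homotopic _ }⟩

end PreAbstractSimplicialComplex

/-! ### Independence complexes -/

namespace SimpleGraph

open PreAbstractSimplicialComplex

variable {V : Type*} (G : SimpleGraph V)

theorem closedNeighborhoodComplex_compl :
    Gᶜ.closedNeighborhoodComplex = dowkerComplex fun v w => ¬ G.Adj v w := by
  refine PreAbstractSimplicialComplex.ext (Set.ext fun s => and_congr_right fun _ =>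
    exists_congr fun v => forall_congr' fun w => imp_congr_right fun _ => ?_)
  simp only [closedNeighborhood, Set.mem_union, mem_neighborSet, compl_adj, Set.mem_singleton_iff,
    G.adj_comm w v]
  constructor
  · rintro (h | rfl)
    exacts [h.2, G.irrefl]
  · intro h
    by_cases hw : w = v
    exacts [Or.inr hw, Or.inl ⟨Ne.symm hw, h⟩]

/-- The vertices of the canonical double covering, as two copies of the vertex set. -/
def doubleCoveringEquiv (V : Type*) : V ⊕ V ≃ Fin 2 × V where
  toFun := Sum.elim (fun v => (0, v)) fun v => (1, v)
  invFun q := if q.1 = 0 then Sum.inl q.2 else Sum.inr q.2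
  left_inv := by rintro (v | v) <;> simp
  right_inv := by
    rintro ⟨i, v⟩
    fin_cases i <;> simp

theorem map_mem_independenceComplex_canonicalDoubleCovering (s : Finset (V ⊕ V)) :
    s.map (doubleCoveringEquiv V).toEmbedding ∈
        G.canonicalDoubleCovering.independenceComplex.faces ↔
      s ∈ (bicliqueComplex fun v w => ¬ G.Adj v w).faces := by
  refine and_congr Finset.map_nonempty ?_
  rw [Finset.coe_map]
  constructor
  · intro h v w hv hw hvw
    exact h (Set.mem_image_of_mem _ hv) (Set.mem_image_of_mem _ hw)
      (fun h => by simp [doubleCoveringEquiv] at h)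
      ⟨by simp [doubleCoveringEquiv], hvw⟩
  · rintro h _ ⟨v | v, hv, rfl⟩ _ ⟨w | w, hw, rfl⟩ - ⟨h1, h2⟩
    · exact absurd rfl h1
    · exact h v w hv hw h2
    · exact h w v hw hv h2.symm
    · exact absurd rfl h1

/-- For a two-coloring `c`, the involution of two copies of the vertex set that exchanges the copies
of the vertices of one of the colors. -/
def sideEquiv (c : V → Fin 2) : V ⊕ V ≃ V ⊕ V where
  toFun := Sum.elim (fun v => if c v = 0 then Sum.inl v else Sum.inr v)
    fun v => if c v = 0 then Sum.inr v else Sum.inl v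
  invFun := Sum.elim (fun v => if c v = 0 then Sum.inl v else Sum.inr v)
    fun v => if c v = 0 then Sum.inr v else Sum.inl v
  left_inv := by rintro (v | v) <;> by_cases h : c v = 0 <;> simp [h]
  right_inv := by rintro (v | v) <;> by_cases h : c v = 0 <;> simp [h]

theorem map_sideEquiv_mem_join (c : G.Coloring (Fin 2)) (s : Finset (V ⊕ V)) :
    s.map (sideEquiv c).toEmbedding ∈ (G.independenceComplex.join G.independenceComplex).faces ↔
      s ∈ (bicliqueComplex fun v w => ¬ G.Adj v w).faces := by
  have hmem : ∀ u, u ∈ s.map (sideEquiv c).toEmbedding ↔ sideEquiv c u ∈ s := fun u =>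
    Finset.mem_map_equiv
  have hface : ∀ t : Finset V, (t = ∅ ∨ t ∈ G.independenceComplex.faces) ↔
      ∀ v ∈ t, ∀ w ∈ t, ¬ G.Adj v w := fun t => by
    constructor
    · rintro (rfl | ht) v hv w hw hvw
      · simp at hv
      · exact ht.2 hv hw hvw.ne hvw
    · intro h
      exact t.eq_empty_or_nonempty.imp id fun ht => ⟨ht, fun v hv w hw _ => h v hv w hw⟩
  refine and_congr Finset.map_nonempty ?_
  rw [hface, hface]
  simp only [Finset.mem_toLeft, Finset.mem_toRight, hmem]
  have h2 : ∀ {v w}, G.Adj v w → (c v = 0 ↔ c w ≠ 0) := fun {v w} hvw => by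
    have := c.valid hvw
    omega
  constructor
  · rintro ⟨hl, hr⟩ v w hv hw hvw
    by_cases hc : c v = 0
    · exact hl v (by simpa [sideEquiv, hc] using hv) w
        (by simpa [sideEquiv, (h2 hvw).1 hc] using hw) hvw
    · exact hr v (by simpa [sideEquiv, hc] using hv) w
        (by simpa [sideEquiv, not_not.1 (mt (h2 hvw).2 hc)] using hw) hvw
  · refine fun h => ⟨fun v hv w hw hvw => ?_, fun v hv w hw hvw => ?_⟩ <;>
      by_cases hc : c v = 0
    · exact h v w (by simpa [sideEquiv, hc] using hv)
        (by simpa [sideEquiv, (h2 hvw).1 hc] using hw) hvw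
    · exact h w v (by simpa [sideEquiv, not_not.1 (mt (h2 hvw).2 hc)] using hw)
        (by simpa [sideEquiv, hc] using hv) hvw.symm
    · exact h w v (by simpa [sideEquiv, (h2 hvw).1 hc] using hw)
        (by simpa [sideEquiv, hc] using hv) hvw.symm
    · exact h v w (by simpa [sideEquiv, hc] using hv)
        (by simpa [sideEquiv, not_not.1 (mt (h2 hvw).2 hc)] using hw) hvw

end SimpleGraph

theorem theorem1p2 {V : Type*} [Nonempty V] (G : SimpleGraph V) :
    Nonempty (ContinuousMap.HomotopyEquiv
      (Suspension Gᶜ.closedNeighborhoodComplex.Realization)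
      G.canonicalDoubleCovering.independenceComplex.Realization) ∧
    (G.IsBipartite →
      Nonempty (ContinuousMap.HomotopyEquiv
        (Suspension Gᶜ.closedNeighborhoodComplex.Realization)
        (G.independenceComplex.join G.independenceComplex).Realization)) := by
  obtain ⟨v⟩ := ‹Nonempty V›
  obtain ⟨e⟩ := PreAbstractSimplicialComplex.nonempty_suspension_dowkerComplex_homotopyEquiv
    (R := fun v w => ¬ G.Adj v w) ⟨v, v, G.irrefl⟩
  rw [G.closedNeighborhoodComplex_compl]
  refine ⟨⟨e.trans (PreAbstractSimplicialComplex.Realization.homeomorphOfEquiv _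
    G.map_mem_independenceComplex_canonicalDoubleCovering).toHomotopyEquiv⟩, ?_⟩
  rintro ⟨c⟩
  exact ⟨e.trans (PreAbstractSimplicialComplex.Realization.homeomorphOfEquiv _
    (G.map_sideEquiv_mem_join c)).toHomotopyEquiv⟩
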